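/- Let $S$ be a finite set. Let $b : 2^S \to \mathbb{Z}\cup\{+\infty\}$ be a set function with $b(\emptyset)=0$ that is submodular, i.e. $b(X)+b(Y)\ge b(X\cap Y)+b(X\cup Y)$ for all $X,Y\subseteq S$ with $b(X),b(Y)<+\infty$. Suppose that the integral base-polyhedron $$B=\Bigl\{x\in\mathbb{R}^S : \sum_{v\in S}x(v)=b(S),\ \sum_{v\in Z}x(v)\le b(Z)\ \text{for every } Z\subseteq S\Bigr\}$$ is nonempty ($B$ may be unbounded). An element $x$ of $B\cap\mathbb{Z}^S$ is called decreasingly minimal (dec-min) if, for every $y\in B\cap\mathbb{Z}^S$, the vector of the components of $x$ arranged in decreasing order is equal to, or lexicographically smaller than, the vector of the components of $y$ arranged in decreasing order. Then $B$ has a unique point of minimum Euclidean norm, and this point is a convex combination of dec-min elements of $B\cap\mathbb{Z}^S$. -/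

import Mathlib

/-- A set function `b` with values in `R ∪ {+∞}` is submodular if the submodular inequality holds
for all pairs of sets at which `b` is finite. -/
def IsSubmodular {S R : Type*} [DecidableEq S] [Add R] [LE R]
    (b : Finset S → WithTop R) : Prop :=
  ∀ X Y : Finset S, b X ≠ ⊤ → b Y ≠ ⊤ → b (X ∩ Y) + b (X ∪ Y) ≤ b X + b Y

/-- The (possibly unbounded) polyhedron
`B(b) = {x ∈ ℝ^S : x(S) = b(S), x(Z) ≤ b(Z) for every Z ⊆ S}`. -/
def basePolyhedron {S : Type*} [Fintype S] (b : Finset S → WithTop ℝ) :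
    Set (EuclideanSpace ℝ S) :=
  {x | ((∑ v, x v : ℝ) : WithTop ℝ) = b Finset.univ ∧
    ∀ Z : Finset S, ((∑ v ∈ Z, x v : ℝ) : WithTop ℝ) ≤ b Z}

/-- An integral base-polyhedron: one described by an integer-valued (possibly `+∞`)
submodular set function `b` with `b(∅) = 0`. -/
def IsIntegralBasePolyhedron {S : Type*} [Fintype S] [DecidableEq S]
    (B : Set (EuclideanSpace ℝ S)) : Prop :=
  ∃ b : Finset S → WithTop ℤ, b ∅ = 0 ∧ IsSubmodular b ∧
    B = basePolyhedron (fun Z => (b Z).map (fun k : ℤ => (k : ℝ)))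

/-- The set of integral members of `B`. -/
def integralPoints {S : Type*} (B : Set (EuclideanSpace ℝ S)) : Set (EuclideanSpace ℝ S) :=
  {x | x ∈ B ∧ ∀ s, ∃ k : ℤ, x s = (k : ℝ)}

/-- The components of `x` rearranged in decreasing order. -/
noncomputable def decSeq {S : Type*} [Fintype S] (x : EuclideanSpace ℝ S) : List ℝ :=
  (Finset.univ.val.map fun s => x s).sort (· ≥ ·)

/-- `x` and `y` are value-equivalent. -/
def ValueEquivalent {S : Type*} [Fintype S] (x y : EuclideanSpace ℝ S) : Prop :=
  decSeq x = decSeq y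

/-- `x` is decreasingly smaller than `y`: the decreasing rearrangement of `x` is
lexicographically smaller than that of `y`. -/
def DecSmaller {S : Type*} [Fintype S] (x y : EuclideanSpace ℝ S) : Prop :=
  List.Lex (· < ·) (decSeq x) (decSeq y)

/-- `x` is a decreasingly minimal element of `Q`. -/
def IsDecMin {S : Type*} [Fintype S] (Q : Set (EuclideanSpace ℝ S))
    (x : EuclideanSpace ℝ S) : Prop :=
  x ∈ Q ∧ ∀ y ∈ Q, DecSmaller x y ∨ ValueEquivalent x y

/-- `m` is a point of `B` with minimum Euclidean norm. -/
def IsMinNormPoint {S : Type*} [Fintype S] (B : Set (EuclideanSpace ℝ S))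
    (m : EuclideanSpace ℝ S) : Prop :=
  m ∈ B ∧ ∀ x ∈ B, ‖m‖ ≤ ‖x‖

open Filter Topology

/-! ### Linear and topological facts about coordinates. -/

section Coordinates

variable {S : Type*}

/-! Let `m` be the minimum norm point. If `m s < m t`, shifting a little mass from `t` to `s` would
shorten `m`, so some tight set contains `s` but not `t`. By submodularity tight sets are closed
under union and intersection, hence every level set of `m` is tight
(`IsMinNormPoint.isTightSet_level`). Thus `m` lies in `roundingPolytope b m`. An integral `x` there
satisfies, for each integer `k`, `x ≤ k` on the set `m ≤ k` and `x ≥ k` off it. Tightness of that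
set makes the mass of `x` off it least possible, so `x` minimizes the total excess over `k`; having
this for all `k` forces dec-minimality (`isDecMin_of_mem_roundingPolytope`). Finally the polytope is
compact with integral extreme points, so Krein-Milman writes `m` as a convex combination of its
integral points. -/

theorem sum_single_sub_single [DecidableEq S] (Z : Finset S) (s t : S) :
    ∑ v ∈ Z, (EuclideanSpace.single s (1 : ℝ) - EuclideanSpace.single t 1 : EuclideanSpace ℝ S) v =
      (if s ∈ Z then 1 else 0) - (if t ∈ Z then 1 else 0) := by
  simp [Finset.sum_sub_distrib]

theorem convex_setOf_sum_eq (Z : Finset S) (c : ℝ) :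
    Convex ℝ {x : EuclideanSpace ℝ S | ∑ v ∈ Z, x v = c} := by
  intro x hx y hy p q _ _ hpq
  simp only [Set.mem_ofPred_eq] at hx hy ⊢
  simp only [PiLp.add_apply, PiLp.smul_apply, smul_eq_mul, Finset.sum_add_distrib,
    ← Finset.mul_sum, hx, hy]
  rw [← add_mul, hpq, one_mul]

theorem isCompact_box (l u : S → ℝ) :
    IsCompact {x : EuclideanSpace ℝ S | ∀ v, l v ≤ x v ∧ x v ≤ u v} := by
  have h : IsCompact (Set.Icc l u) := isCompact_Icc
  have := h.image (PiLp.continuous_toLp 2 fun _ : S => ℝ)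
  convert this using 1
  ext x
  constructor
  · exact fun hx => ⟨x.ofLp, ⟨fun v => (hx v).1, fun v => (hx v).2⟩, rfl⟩
  · rintro ⟨z, hz, rfl⟩
    exact fun v => ⟨hz.1 v, hz.2 v⟩

end Coordinates

/-! ### Tight sets and feasible directions of the base-polyhedron. -/

section Tight

variable {S : Type*} [Fintype S]

/-- The real-valued set function underlying an integer-valued one. -/
abbrev realSetFunction (b : Finset S → WithTop ℤ) : Finset S → WithTop ℝ :=
  fun Z => (b Z).map (fun k : ℤ => (k : ℝ))

/-- `Z` is tight for `x` when `x(Z) = b(Z)`. -/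
def IsTightSet (b : Finset S → WithTop ℤ) (x : EuclideanSpace ℝ S) (Z : Finset S) : Prop :=
  ∃ k : ℤ, b Z = k ∧ ∑ v ∈ Z, x v = k

theorem mem_basePolyhedron_iff {b : Finset S → WithTop ℤ} {x : EuclideanSpace ℝ S} :
    x ∈ basePolyhedron (realSetFunction b) ↔
      IsTightSet b x Finset.univ ∧ ∀ (Z : Finset S) (k : ℤ), b Z = k → ∑ v ∈ Z, x v ≤ k := by
  unfold basePolyhedron IsTightSet realSetFunction
  refine and_congr ?_ (forall_congr' fun Z => ?_)
  · cases h : b Finset.univ with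
    | top => simp
    | coe k =>
      rw [WithTop.map_coe]
      constructor
      · intro h
        exact ⟨k, rfl, WithTop.coe_injective h⟩
      · rintro ⟨l, hl, h⟩
        rw [h, WithTop.coe_injective hl]
  · cases h : b Z with
    | top => simp
    | coe k =>
      rw [WithTop.map_coe, WithTop.coe_le_coe]
      constructor
      · intro h l hl
        rwa [← WithTop.coe_injective hl]
      · intro h
        exact h k rfl

/-- Since `x` is modular, submodularity squeezes the two upper bounds on the intersection and the
union into equalities. -/
theorem IsTightSet.inter_union [DecidableEq S] {b : Finset S → WithTop ℤ} (hb : IsSubmodular b)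
    {x : EuclideanSpace ℝ S} (hx : x ∈ basePolyhedron (realSetFunction b)) {X Y : Finset S}
    (hX : IsTightSet b x X) (hY : IsTightSet b x Y) :
    IsTightSet b x (X ∩ Y) ∧ IsTightSet b x (X ∪ Y) := by
  obtain ⟨k, hk, hxk⟩ := hX
  obtain ⟨l, hl, hyl⟩ := hY
  have hsub := hb X Y (by simp [hk]) (by simp [hl])
  have hle := (mem_basePolyhedron_iff.1 hx).2
  have hsum := Finset.sum_union_inter (s₁ := X) (s₂ := Y) (f := fun v => x v)
  rw [hk, hl] at hsub
  cases hi : b (X ∩ Y) with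
  | top => simp [hi, ← WithTop.coe_add] at hsub
  | coe p =>
    cases hu : b (X ∪ Y) with
    | top => simp [hu, ← WithTop.coe_add] at hsub
    | coe q =>
      rw [hi, hu, ← WithTop.coe_add, ← WithTop.coe_add, WithTop.coe_le_coe] at hsub
      have h1 := hle _ _ hi
      have h2 := hle _ _ hu
      have h3 : (p : ℝ) + q ≤ k + l := by exact_mod_cast hsub
      exact ⟨⟨p, hi, by linarith⟩, ⟨q, hu, by linarith⟩⟩

/-- A set is tight as soon as each of its elements can be separated from each outside element
by a tight set. -/
theorem isTightSet_of_separated [DecidableEq S] {b : Finset S → WithTop ℤ} (h0 : b ∅ = 0)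
    (hb : IsSubmodular b) {x : EuclideanSpace ℝ S}
    (hx : x ∈ basePolyhedron (realSetFunction b)) (L : Finset S)
    (h : ∀ s ∈ L, ∀ t ∉ L, ∃ Z, IsTightSet b x Z ∧ s ∈ Z ∧ t ∉ Z) : IsTightSet b x L := by
  classical
  -- For fixed `s`, intersect the separating sets over all `t ∉ L`; the union of the results over `s
  -- ∈ L` is then `L`.
  have hinter : ∀ s ∈ L, ∃ Z, IsTightSet b x Z ∧ s ∈ Z ∧ Z ⊆ L := by
    intro s hs
    have key : ∀ T : Finset S, (∀ t ∈ T, t ∉ L) →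
        ∃ Z, IsTightSet b x Z ∧ s ∈ Z ∧ ∀ t ∈ T, t ∉ Z := by
      intro T
      induction T using Finset.induction_on with
      | empty => exact fun _ => ⟨Finset.univ, (mem_basePolyhedron_iff.1 hx).1, by simp, by simp⟩
      | insert t T _ ih =>
        intro hT
        obtain ⟨Z, hZ, hsZ, hTZ⟩ := ih fun t' ht' => hT t' (by simp [ht'])
        obtain ⟨W, hW, hsW, htW⟩ := h s hs t (hT t (by simp))
        refine ⟨Z ∩ W, (hZ.inter_union hb hx hW).1, by simp [hsZ, hsW], ?_⟩
        intro t' ht' hmem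
        rw [Finset.mem_inter] at hmem
        rcases Finset.mem_insert.1 ht' with rfl | ht'
        · exact htW hmem.2
        · exact hTZ t' ht' hmem.1
    obtain ⟨Z, hZ, hsZ, hout⟩ := key Lᶜ (by simp)
    refine ⟨Z, hZ, hsZ, fun v hv => ?_⟩
    by_contra hvL
    exact hout v (by simpa using hvL) hv
  have key : ∀ T ⊆ L, ∃ Z, IsTightSet b x Z ∧ T ⊆ Z ∧ Z ⊆ L := by
    intro T
    induction T using Finset.induction_on with
    | empty => exact fun _ => ⟨∅, ⟨0, h0, by simp⟩, by simp, by simp⟩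
    | insert s T _ ih =>
      intro hT
      rw [Finset.insert_subset_iff] at hT
      obtain ⟨Z, hZ, hTZ, hZL⟩ := ih hT.2
      obtain ⟨W, hW, hsW, hWL⟩ := hinter s hT.1
      refine ⟨Z ∪ W, (hZ.inter_union hb hx hW).2, ?_, Finset.union_subset hZL hWL⟩
      rw [Finset.insert_subset_iff]
      exact ⟨by simp [hsW], hTZ.trans Finset.subset_union_left⟩
  obtain ⟨Z, hZ, hLZ, hZL⟩ := key L subset_rfl
  rwa [hLZ.antisymm hZL]

/-- A direction that does not increase any tight set is feasible. -/
theorem eventually_add_smul_mem_basePolyhedron {b : Finset S → WithTop ℤ}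
    {x d : EuclideanSpace ℝ S} (hx : x ∈ basePolyhedron (realSetFunction b))
    (hd : ∑ v, d v = 0) (htight : ∀ Z, IsTightSet b x Z → ∑ v ∈ Z, d v ≤ 0) :
    ∀ᶠ δ : ℝ in 𝓝[>] 0, x + δ • d ∈ basePolyhedron (realSetFunction b) := by
  have hx' := mem_basePolyhedron_iff.1 hx
  have hsum : ∀ (Z : Finset S) (δ : ℝ),
      ∑ v ∈ Z, (x + δ • d) v = ∑ v ∈ Z, x v + δ * ∑ v ∈ Z, d v := by
    intro Z δ
    simp [Finset.sum_add_distrib, Finset.mul_sum]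
  have hZ : ∀ Z : Finset S, ∀ᶠ δ : ℝ in 𝓝[>] 0,
      ∀ k : ℤ, b Z = k → ∑ v ∈ Z, (x + δ • d) v ≤ k := by
    intro Z
    cases hbZ : b Z with
    | top => simp
    | coe k =>
      simp only [WithTop.coe_inj, forall_eq', hsum]
      rcases (hx'.2 Z k hbZ).lt_or_eq with hlt | heq
      · have hcont : Continuous fun δ : ℝ => ∑ v ∈ Z, x v + δ * ∑ v ∈ Z, d v := by fun_prop
        have := (hcont.tendsto 0).eventually_lt_const (u := (k : ℝ)) (by simpa using hlt)
        exact (this.filter_mono nhdsWithin_le_nhds).mono fun δ h => h.le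
      · filter_upwards [self_mem_nhdsWithin] with δ hδ
        have := mul_nonpos_of_nonneg_of_nonpos (le_of_lt hδ) (htight Z ⟨k, hbZ, heq⟩)
        linarith
  filter_upwards [eventually_all.2 hZ] with δ hδ
  refine mem_basePolyhedron_iff.2 ⟨?_, hδ⟩
  obtain ⟨k, hk, hxk⟩ := hx'.1
  exact ⟨k, hk, by rw [hsum, hd, mul_zero, add_zero, hxk]⟩

theorem isClosed_basePolyhedron (b : Finset S → WithTop ℤ) :
    IsClosed (basePolyhedron (realSetFunction b)) := by
  have : basePolyhedron (realSetFunction b) =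
      (⋃ k : {k : ℤ // b Finset.univ = k}, {x : EuclideanSpace ℝ S | ∑ v, x v = (k : ℤ)}) ∩
      ⋂ (Z : Finset S) (k : ℤ) (_ : b Z = k), {x : EuclideanSpace ℝ S | ∑ v ∈ Z, x v ≤ k} := by
    ext x
    simp [mem_basePolyhedron_iff, IsTightSet]
  rw [this]
  refine IsClosed.inter ?_ ?_
  · have : Subsingleton {k : ℤ // b Finset.univ = k} :=
      ⟨fun k l => Subtype.ext (WithTop.coe_injective (k.2.symm.trans l.2))⟩
    exact isClosed_iUnion_of_finite fun k => isClosed_eq (by fun_prop) (by fun_prop)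
  · exact isClosed_iInter fun Z => isClosed_iInter fun k => isClosed_iInter fun _ =>
      isClosed_le (by fun_prop) (by fun_prop)

theorem convex_basePolyhedron (b : Finset S → WithTop ℤ) :
    Convex ℝ (basePolyhedron (realSetFunction b)) := by
  intro x hx y hy p q hp hq hpq
  rw [mem_basePolyhedron_iff] at hx hy ⊢
  constructor
  · obtain ⟨k, hk, hxk⟩ := hx.1
    obtain ⟨l, hl, hyl⟩ := hy.1
    rw [← WithTop.coe_injective (hk.symm.trans hl)] at hyl
    exact ⟨k, hk, convex_setOf_sum_eq _ _ hxk hyl hp hq hpq⟩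
  · intro Z k hk
    have h1 := mul_le_mul_of_nonneg_left (hx.2 Z k hk) hp
    have h2 := mul_le_mul_of_nonneg_left (hy.2 Z k hk) hq
    simp only [PiLp.add_apply, PiLp.smul_apply, smul_eq_mul, Finset.sum_add_distrib,
      ← Finset.mul_sum]
    calc _ ≤ p * (k : ℝ) + q * k := add_le_add h1 h2
      _ = k := by rw [← add_mul, hpq, one_mul]

end Tight

/-! ### The minimum norm point and its tight level sets. -/

section MinNorm

variable {S : Type*} [Fintype S]

theorem existsUnique_isMinNormPoint {B : Set (EuclideanSpace ℝ S)} (hne : B.Nonempty)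
    (hcl : IsClosed B) (hconv : Convex ℝ B) : ∃! m, IsMinNormPoint B m := by
  obtain ⟨m, hm, hdist⟩ := hcl.exists_infDist_eq_dist hne 0
  have hmin : ∀ x ∈ B, ‖m‖ ≤ ‖x‖ := by
    intro x hx
    have := Metric.infDist_le_dist_of_mem (x := (0 : EuclideanSpace ℝ S)) hx
    rw [hdist] at this
    simpa using this
  refine ⟨m, ⟨hm, hmin⟩, ?_⟩
  rintro y ⟨hy, hymin⟩
  by_contra hne
  have heq : ‖y‖ = ‖m‖ := le_antisymm (hymin m hm) (hmin y hy)
  -- By strict convexity the midpoint of two distinct minimizers would be shorter.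
  have hlt := norm_combo_lt_of_ne heq.le le_rfl hne (a := (1 / 2 : ℝ)) (b := 1 / 2)
    (by norm_num) (by norm_num) (by norm_num)
  have := hmin _ (hconv hy hm (a := (1 / 2 : ℝ)) (b := 1 / 2)
    (by norm_num) (by norm_num) (by norm_num))
  linarith

/-- Elements with different values in the minimum norm point are separated by a tight set. -/
theorem IsMinNormPoint.exists_isTightSet [DecidableEq S] {b : Finset S → WithTop ℤ}
    {m : EuclideanSpace ℝ S} (hm : IsMinNormPoint (basePolyhedron (realSetFunction b)) m)
    {s t : S} (hst : m s < m t) : ∃ Z, IsTightSet b m Z ∧ s ∈ Z ∧ t ∉ Z := by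
  by_contra! hcon
  set d : EuclideanSpace ℝ S := EuclideanSpace.single s 1 - EuclideanSpace.single t 1 with hd
  have hfeas := eventually_add_smul_mem_basePolyhedron (d := d) hm.1
    (by rw [hd, sum_single_sub_single]; simp)
    (by
      intro Z hZ
      rw [hd, sum_single_sub_single]
      by_cases hs : s ∈ Z
      · simp [hs, hcon Z hZ hs]
      · by_cases ht : t ∈ Z <;> simp [hs, ht])
  -- The squared norm changes by `2δ(δ - (m t - m s))`, which is negative for these `δ`.
  have hsmall : ∀ᶠ δ : ℝ in 𝓝[>] 0, δ < m t - m s :=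
    (eventually_lt_nhds (sub_pos.2 hst)).filter_mono nhdsWithin_le_nhds
  obtain ⟨δ, hmem, hlt, hpos⟩ := (hfeas.and (hsmall.and self_mem_nhdsWithin)).exists
  have hpos : 0 < δ := hpos
  have hle := hm.2 _ hmem
  have hne : s ≠ t := fun h => by simp [h] at hst
  have hsq : ‖m‖ ^ 2 ≤ ‖m + δ • d‖ ^ 2 := by gcongr
  have hdd : ‖d‖ ^ 2 = 2 := by
    rw [hd, @norm_sub_sq_real]
    simp [EuclideanSpace.inner_single_left, hne]
    norm_num
  have hmd : inner ℝ m d = m s - m t := by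
    rw [hd, inner_sub_right]
    simp [EuclideanSpace.inner_single_right]
  rw [@norm_add_sq_real, norm_smul, mul_pow, hdd, inner_smul_right, hmd, Real.norm_eq_abs,
    sq_abs] at hsq
  nlinarith

theorem IsMinNormPoint.isTightSet_level [DecidableEq S] {b : Finset S → WithTop ℤ} (h0 : b ∅ = 0)
    (hb : IsSubmodular b) {m : EuclideanSpace ℝ S}
    (hm : IsMinNormPoint (basePolyhedron (realSetFunction b)) m) (k : ℝ) :
    IsTightSet b m {v | m v ≤ k} := by
  refine isTightSet_of_separated h0 hb hm.1 _ fun s hs t ht => hm.exists_isTightSet ?_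
  simp only [Finset.mem_filter, Finset.mem_univ, true_and, not_le] at hs ht
  exact hs.trans_lt ht

end MinNorm

/-! ### Dec-minimality from minimal excess over integer thresholds. -/

section DecMin

/-- At the first differing entries, take `k` to be the entry of `l₂`: the remaining excess of `l₂`
vanishes, so the entry of `l₁` cannot be larger. -/
theorem lex_or_eq_of_sum_max_le (l₁ l₂ : List ℝ) (hlen : l₁.length = l₂.length)
    (hl₁ : l₁.Pairwise (· ≥ ·)) (hl₂ : l₂.Pairwise (· ≥ ·))
    (h : ∀ k ∈ l₂, (l₁.map fun a => max (a - k) 0).sum ≤ (l₂.map fun a => max (a - k) 0).sum) :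
    List.Lex (· < ·) l₁ l₂ ∨ l₁ = l₂ := by
  induction l₁ generalizing l₂ with
  | nil => exact Or.inr (List.length_eq_zero_iff.1 hlen.symm).symm
  | cons a l₁ ih =>
    cases l₂ with
    | nil => simp at hlen
    | cons c l₂ =>
      rw [List.pairwise_cons] at hl₁ hl₂
      rcases lt_trichotomy a c with hac | rfl | hca
      · exact Or.inl (List.Lex.rel hac)
      · have := ih l₂ (by simpa using hlen) hl₁.2 hl₂.2 fun k hk => by
          simpa using h k (List.mem_cons_of_mem _ hk)
        rcases this with hlex | rfl
        · exact Or.inl (List.Lex.cons hlex)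
        · exact Or.inr rfl
      · have hc := h c (by simp)
        have hzero : (l₂.map fun a => max (a - c) 0).sum = 0 := by
          refine List.sum_eq_zero fun r hr => ?_
          obtain ⟨a', ha', rfl⟩ := List.mem_map.1 hr
          exact max_eq_right (sub_nonpos.2 (hl₂.1 a' ha'))
        have hnonneg : 0 ≤ (l₁.map fun a => max (a - c) 0).sum := by
          refine List.sum_nonneg fun r hr => ?_
          obtain ⟨a', -, rfl⟩ := List.mem_map.1 hr
          exact le_max_right _ _
        simp only [List.map_cons, List.sum_cons, hzero, sub_self, max_self, add_zero] at hc
        have := le_max_left (a - c) 0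
        linarith

variable {S : Type*} [Fintype S]

theorem sum_map_decSeq (x : EuclideanSpace ℝ S) (f : ℝ → ℝ) :
    ((decSeq x).map f).sum = ∑ v, f (x v) := by
  rw [← Multiset.sum_coe, ← Multiset.map_coe, decSeq, Multiset.sort_eq, Multiset.map_map]
  rfl

theorem decSmaller_or_valueEquivalent_of_sum_max_le {x y : EuclideanSpace ℝ S}
    (h : ∀ s, ∑ v, max (x v - y s) 0 ≤ ∑ v, max (y v - y s) 0) :
    DecSmaller x y ∨ ValueEquivalent x y := by
  refine lex_or_eq_of_sum_max_le _ _ (by simp [decSeq]) (Multiset.pairwise_sort _ _)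
    (Multiset.pairwise_sort _ _) fun k hk => ?_
  obtain ⟨s, rfl⟩ : ∃ s, y s = k := by simpa [decSeq] using hk
  simpa only [sum_map_decSeq x fun a => max (a - y s) 0,
    sum_map_decSeq y fun a => max (a - y s) 0] using h s

/-- The elements of the base-polyhedron in the unit box around `m` for which all the integral
level sets of `m` are tight. -/
def roundingPolytope (b : Finset S → WithTop ℤ) (m : EuclideanSpace ℝ S) :
    Set (EuclideanSpace ℝ S) :=
  {x | x ∈ basePolyhedron (realSetFunction b) ∧ (∀ v, (⌊m v⌋ : ℝ) ≤ x v ∧ x v ≤ ⌈m v⌉) ∧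
    ∀ k : ℤ, IsTightSet b x {v | m v ≤ k}}

theorem isDecMin_of_mem_roundingPolytope {b : Finset S → WithTop ℤ}
    {m x : EuclideanSpace ℝ S} (hx : x ∈ integralPoints (roundingPolytope b m)) :
    IsDecMin (integralPoints (basePolyhedron (realSetFunction b))) x := by
  classical
  obtain ⟨⟨hxB, hbox, hlevel⟩, hint⟩ := hx
  refine ⟨⟨hxB, hint⟩, fun y hy => decSmaller_or_valueEquivalent_of_sum_max_le fun s => ?_⟩
  -- Thresholds are values of the integral point `y`, so integer `k` suffice.
  obtain ⟨k, hk⟩ := hy.2 s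
  rw [hk]
  set L : Finset S := {v | m v ≤ k} with hL
  obtain ⟨p, hp, hxp⟩ := hlevel k
  have hyp := (mem_basePolyhedron_iff.1 hy.1).2 L p hp
  obtain ⟨q, hq, hxq⟩ := (mem_basePolyhedron_iff.1 hxB).1
  obtain ⟨q', hq', hyq⟩ := (mem_basePolyhedron_iff.1 hy.1).1
  rw [← WithTop.coe_injective (hq.symm.trans hq')] at hyq
  rw [← Finset.sum_add_sum_compl L] at hxq hyq
  have h1 : ∑ v ∈ L, max (x v - k) 0 = 0 := by
    refine Finset.sum_eq_zero fun v hv => max_eq_right ?_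
    have hv' : m v ≤ k := by simpa [hL] using hv
    have : (⌈m v⌉ : ℝ) ≤ k := by exact_mod_cast Int.ceil_le.2 hv'
    linarith [(hbox v).2]
  have h2 : ∑ v ∈ Lᶜ, max (x v - k) 0 = ∑ v ∈ Lᶜ, (x v - k) := by
    refine Finset.sum_congr rfl fun v hv => max_eq_left ?_
    have hv' : (k : ℝ) < m v := by simpa [hL] using hv
    have : (k : ℝ) ≤ ⌊m v⌋ := by exact_mod_cast Int.le_floor.2 hv'.le
    linarith [(hbox v).1]
  have h3 : ∑ v ∈ Lᶜ, (y v - k) ≤ ∑ v ∈ Lᶜ, max (y v - k) 0 :=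
    Finset.sum_le_sum fun v _ => le_max_left _ _
  have h4 : 0 ≤ ∑ v ∈ L, max (y v - k) 0 := Finset.sum_nonneg fun v _ => le_max_right _ _
  rw [← Finset.sum_add_sum_compl L, ← Finset.sum_add_sum_compl L, h1, h2]
  rw [Finset.sum_sub_distrib] at h3 ⊢
  linarith

end DecMin

/-! ### Integrality of the rounding polytope. -/

section Integrality

variable {S : Type*} [Fintype S]

theorem convex_roundingPolytope (b : Finset S → WithTop ℤ) (m : EuclideanSpace ℝ S) :
    Convex ℝ (roundingPolytope b m) := by
  intro x hx y hy p q hp hq hpq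
  refine ⟨convex_basePolyhedron b hx.1 hy.1 hp hq hpq, fun v => ?_, fun k => ?_⟩
  · exact convex_Icc (⌊m v⌋ : ℝ) ⌈m v⌉ (hx.2.1 v) (hy.2.1 v) hp hq hpq
  · obtain ⟨k', hk, hxk⟩ := hx.2.2 k
    obtain ⟨l, hl, hyl⟩ := hy.2.2 k
    rw [← WithTop.coe_injective (hk.symm.trans hl)] at hyl
    exact ⟨k', hk, convex_setOf_sum_eq _ _ hxk hyl hp hq hpq⟩

theorem isClosed_setOf_isTightSet (b : Finset S → WithTop ℤ) (Z : Finset S) :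
    IsClosed {x : EuclideanSpace ℝ S | IsTightSet b x Z} := by
  unfold IsTightSet
  cases b Z with
  | top => simp
  | coe k =>
    simp only [WithTop.coe_inj, exists_eq_left']
    exact isClosed_eq (by fun_prop) (by fun_prop)

theorem isCompact_roundingPolytope (b : Finset S → WithTop ℤ) (m : EuclideanSpace ℝ S) :
    IsCompact (roundingPolytope b m) := by
  refine (isCompact_box (fun v => (⌊m v⌋ : ℝ)) fun v => ⌈m v⌉).of_isClosed_subset ?_
    fun x hx => hx.2.1
  have hlevel : IsClosed {x : EuclideanSpace ℝ S | ∀ k : ℤ, IsTightSet b x {v | m v ≤ k}} := by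
    rw [Set.ofPred_forall]
    exact isClosed_iInter fun k => isClosed_setOf_isTightSet b _
  exact (isClosed_basePolyhedron b).inter ((isCompact_box _ _).isClosed.inter hlevel)

theorem finite_integralPoints_roundingPolytope (b : Finset S → WithTop ℤ)
    (m : EuclideanSpace ℝ S) : (integralPoints (roundingPolytope b m)).Finite := by
  classical
  refine ((Set.finite_Icc (fun v => ⌊m v⌋) fun v => ⌈m v⌉).image
    fun z : S → ℤ => WithLp.toLp 2 fun v => (z v : ℝ)).subset ?_
  rintro x ⟨hx, hint⟩
  choose z hz using hint
  refine ⟨z, ⟨fun v => ?_, fun v => ?_⟩, ?_⟩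
  · have := (hx.2.1 v).1
    rw [hz] at this
    exact Int.cast_le.1 this
  · have := (hx.2.1 v).2
    rw [hz] at this
    exact Int.cast_le.1 this
  · ext v
    exact (hz v).symm

/-- Two elements with non-integral values that belong to the same tight sets. -/
theorem exists_pair_not_integral [DecidableEq S] {b : Finset S → WithTop ℤ}
    (hb : IsSubmodular b) {x : EuclideanSpace ℝ S}
    (hx : x ∈ basePolyhedron (realSetFunction b)) (hnon : ¬ ∀ s, ∃ k : ℤ, x s = k) :
    ∃ s t, s ≠ t ∧ (¬ ∃ k : ℤ, x s = k) ∧ (¬ ∃ k : ℤ, x t = k) ∧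
      ∀ Z, IsTightSet b x Z → (s ∈ Z ↔ t ∈ Z) := by
  classical
  push Not at hnon
  obtain ⟨s₀, hs₀⟩ := hnon
  -- In a minimal member `T`, a tight set through one non-integral element contains all of `T`, as
  -- otherwise the intersection would be a smaller member.
  let F : Finset (Finset S) :=
    Finset.univ.filter fun Z => IsTightSet b x Z ∧ ∃ s ∈ Z, ¬ ∃ k : ℤ, x s = k
  have hF : F.Nonempty := ⟨Finset.univ, by
    simpa [F] using ⟨(mem_basePolyhedron_iff.1 hx).1, s₀, hs₀⟩⟩
  obtain ⟨T, hT⟩ := F.exists_minimal hF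
  have hmem : IsTightSet b x T ∧ ∃ s ∈ T, ¬ ∃ k : ℤ, x s = k := (Finset.mem_filter.1 hT.1).2
  obtain ⟨⟨k, hk, hxk⟩, s, hsT, hs⟩ := hmem
  have hkey : ∀ u ∈ T, (¬ ∃ k : ℤ, x u = k) → ∀ Z, IsTightSet b x Z → u ∈ Z → T ⊆ Z := by
    intro u huT hu Z hZ huZ
    have hin : T ∩ Z ∈ F := Finset.mem_filter.2 ⟨Finset.mem_univ _,
      (IsTightSet.inter_union hb hx ⟨k, hk, hxk⟩ hZ).1, u, Finset.mem_inter.2 ⟨huT, huZ⟩, hu⟩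
    exact (hT.2 hin Finset.inter_subset_left).trans Finset.inter_subset_right
  obtain ⟨t, htT, hts, ht⟩ : ∃ t ∈ T, t ≠ s ∧ ¬ ∃ k : ℤ, x t = k := by
    -- The sum over `T` is an integer, so `T` cannot have exactly one non-integral coordinate.
    by_contra! hcon
    have hsum : ∀ t ∈ T.erase s, x t = (round (x t) : ℤ) := by
      intro t ht
      obtain ⟨l, hl⟩ := hcon t (Finset.mem_of_mem_erase ht) (Finset.ne_of_mem_erase ht)
      rw [hl, round_intCast]
    refine hs ⟨k - ∑ t ∈ T.erase s, round (x t), ?_⟩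
    push_cast
    rw [← Finset.sum_congr rfl hsum, ← hxk, ← Finset.add_sum_erase _ _ hsT]
    ring
  exact ⟨s, t, hts.symm, hs, ht, fun Z hZ =>
    ⟨fun h => hkey s hsT hs Z hZ h htT, fun h => hkey t htT ht Z hZ h hsT⟩⟩

/-- Exchanging a little mass between the two elements of `exists_pair_not_integral`, in either
direction, preserves all tight sets. Box bounds are integers, so non-integral coordinates have
slack. Hence `x` would be a midpoint. -/
theorem integral_of_mem_extremePoints [DecidableEq S] {b : Finset S → WithTop ℤ}
    (hb : IsSubmodular b) {m x : EuclideanSpace ℝ S}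
    (hx : x ∈ (roundingPolytope b m).extremePoints ℝ) : ∀ s, ∃ k : ℤ, x s = k := by
  by_contra hnon
  obtain ⟨hxP, hext⟩ := hx
  obtain ⟨s, t, hst, hs, ht, hiff⟩ := exists_pair_not_integral hb hxP.1 hnon
  have hmove : ∀ s t : S, (¬ ∃ k : ℤ, x s = k) → (¬ ∃ k : ℤ, x t = k) →
      (∀ Z, IsTightSet b x Z → (s ∈ Z ↔ t ∈ Z)) → ∀ᶠ δ : ℝ in 𝓝[>] 0,
        x + δ • (EuclideanSpace.single s (1 : ℝ) - EuclideanSpace.single t 1) ∈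
          roundingPolytope b m := by
    intro s t hs ht hiff
    set d : EuclideanSpace ℝ S := EuclideanSpace.single s 1 - EuclideanSpace.single t 1 with hd
    have hzero : ∀ Z, IsTightSet b x Z → ∑ v ∈ Z, d v = 0 := by
      intro Z hZ
      rw [hd, sum_single_sub_single]
      simp [hiff Z hZ]
    have hB := eventually_add_smul_mem_basePolyhedron hxP.1
      (hzero _ (mem_basePolyhedron_iff.1 hxP.1).1) fun Z hZ => (hzero Z hZ).le
    have hbox : ∀ v, ∀ᶠ δ : ℝ in 𝓝[>] 0,
        (⌊m v⌋ : ℝ) ≤ (x + δ • d) v ∧ (x + δ • d) v ≤ ⌈m v⌉ := by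
      intro v
      by_cases hv : ∃ k : ℤ, x v = k
      · have hvs : v ≠ s := fun h => hs (h ▸ hv)
        have hvt : v ≠ t := fun h => ht (h ▸ hv)
        have : d v = 0 := by simp [hd, hvs, hvt]
        exact Eventually.of_forall fun δ => by simpa [this] using hxP.2.1 v
      · have h1 : (⌊m v⌋ : ℝ) < x v := (hxP.2.1 v).1.lt_of_ne fun h => hv ⟨_, h.symm⟩
        have h2 : x v < ⌈m v⌉ := (hxP.2.1 v).2.lt_of_ne fun h => hv ⟨_, h⟩
        have hcont : Continuous fun δ : ℝ => (x + δ • d) v := by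
          simp only [PiLp.add_apply, PiLp.smul_apply, smul_eq_mul]
          fun_prop
        have e1 := (hcont.tendsto 0).eventually_const_lt (u := (⌊m v⌋ : ℝ))
          (by simpa using h1)
        have e2 := (hcont.tendsto 0).eventually_lt_const (u := (⌈m v⌉ : ℝ))
          (by simpa using h2)
        exact ((e1.and e2).filter_mono nhdsWithin_le_nhds).mono fun δ h => ⟨h.1.le, h.2.le⟩
    filter_upwards [hB, eventually_all.2 hbox] with δ hδB hδbox
    refine ⟨hδB, hδbox, fun k => ?_⟩
    obtain ⟨p, hp, hxp⟩ := hxP.2.2 k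
    refine ⟨p, hp, ?_⟩
    have := hzero _ (hxP.2.2 k)
    simp only [PiLp.add_apply, PiLp.smul_apply, smul_eq_mul, Finset.sum_add_distrib,
      ← Finset.mul_sum, this, hxp, mul_zero, add_zero]
  obtain ⟨δ, h1, h2, hpos⟩ := ((hmove s t hs ht hiff).and
    ((hmove t s ht hs fun Z hZ => (hiff Z hZ).symm).and self_mem_nhdsWithin)).exists
  have hpos : 0 < δ := hpos
  have heq := hext h1 h2 ⟨1 / 2, 1 / 2, by norm_num, by norm_num, by norm_num, by module⟩
  have := congrArg (fun z : EuclideanSpace ℝ S => z s) heq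
  simp [hst, hpos.ne'] at this

theorem roundingPolytope_subset_convexHull [DecidableEq S] {b : Finset S → WithTop ℤ}
    (hb : IsSubmodular b) (m : EuclideanSpace ℝ S) :
    roundingPolytope b m ⊆ convexHull ℝ (integralPoints (roundingPolytope b m)) := by
  refine (closure_convexHull_extremePoints (isCompact_roundingPolytope b m)
    (convex_roundingPolytope b m)).symm.subset.trans ?_
  refine closure_minimal (convexHull_mono fun x hx => ?_)
    ((finite_integralPoints_roundingPolytope b m).isClosed_convexHull ℝ)
  exact ⟨hx.1, integral_of_mem_extremePoints hb hx⟩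

end Integrality

theorem mainTheorem8 {S : Type*} [Fintype S] [DecidableEq S]
    (B : Set (EuclideanSpace ℝ S)) (hB : IsIntegralBasePolyhedron B) (hne : B.Nonempty) :
    (∃! m, IsMinNormPoint B m) ∧
      ∀ m, IsMinNormPoint B m → m ∈ convexHull ℝ {x | IsDecMin (integralPoints B) x} := by
  obtain ⟨b, h0, hb, rfl⟩ := hB
  refine ⟨existsUnique_isMinNormPoint hne (isClosed_basePolyhedron b) (convex_basePolyhedron b),
    fun m hm => ?_⟩
  have hmP : m ∈ roundingPolytope b m :=
    ⟨hm.1, fun v => ⟨Int.floor_le _, Int.le_ceil _⟩, fun k => hm.isTightSet_level h0 hb k⟩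
  exact convexHull_mono (fun x hx => isDecMin_of_mem_roundingPolytope hx)
    (roundingPolytope_subset_convexHull hb m hmP)
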